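/- For each integer $N\ge 1$ let $\sigma^{(3)}(N)=\sigma_1\sigma_2\sigma_3$, where $\sigma_1,\sigma_2,\sigma_3$ are independent and each uniformly distributed on the set of $(N-1)!$ maximal cycles (cycles of length $N$) of the symmetric group $S_N$, and let $\nu(s)$ denote the total number of cycles of a permutation $s\in S_N$, fixed points being counted as cycles of length one. Then for all complex numbers $x,y$ with $|x|\le 1$ and $|y|<1$ (with powers taken with the principal branch), the series on the left below converges absolutely, the integrand on the right is integrable on $[0,1]$, and $$\sum_{N\ge 1}\frac{y^N}{N}\,\mathrm{E}\bigl[x^{\nu(\sigma^{(3)}(N))}\bigr]=\int_0^1\frac{(1-y(1-t))^{-x}-(1-y(1-t))^{x}}{1-yt(1-t)}\,dt .$$ -/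

import Mathlib

open scoped BigOperators

/-- The set `C_N` of maximal cycles of the symmetric group on `N` letters: the permutations for
which all letters lie in a single cycle (cycles of length `N`; for `N = 1` this is the identity). -/
def maximalCycles (N : ℕ) : Finset (Equiv.Perm (Fin N)) :=
  Finset.univ.filter fun s => ∀ i j : Fin N, s.SameCycle i j

/-- The total number of cycles of a permutation, fixed points being cycles of length one. -/
def cycleCount {N : ℕ} (s : Equiv.Perm (Fin N)) : ℕ :=
  Multiset.card s.partition.parts

/-- The sample space of `k` independent, uniformly random maximal cycles: all `k`-tuples of
maximal cycles, with the uniform distribution. -/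
def cycleTuples (k N : ℕ) : Finset (Fin k → Equiv.Perm (Fin N)) :=
  Fintype.piFinset fun _ => maximalCycles N

/-- The product `σ₁ σ₂ ⋯ σ_k` of a tuple of permutations. -/
def tupleProduct {k N : ℕ} (s : Fin k → Equiv.Perm (Fin N)) : Equiv.Perm (Fin N) :=
  (List.ofFn s).prod

/-- The expectation `E[x ^ ν(σ)]`, where `ν` is the number of cycles and `σ = σ₁ σ₂ ⋯ σ_k` with
`σ₁, …, σ_k` independent and uniform on the maximal cycles: the mean of
`x ^ ν(σ₁ ⋯ σ_k)` over the uniform sample space `cycleTuples k N`. -/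
noncomputable def expectedCyclePow (k N : ℕ) (x : ℂ) : ℂ :=
  Finset.expect (cycleTuples k N) fun s => x ^ cycleCount (tupleProduct s)

/-- The sample space is not empty, so that the mean over it is a genuine expectation. -/
theorem cycleTuples_nonempty (k N : ℕ) : (cycleTuples k N).Nonempty := by
  have h : finRotate N ∈ maximalCycles N := by
    rcases N with _ | _ | n
    · simp only [maximalCycles, Finset.mem_filter, Finset.mem_univ, true_and]
      exact fun i => i.elim0
    · simp only [maximalCycles, Finset.mem_filter, Finset.mem_univ, true_and]
      intro i j
      have hij : i = j := Fin.ext (by omega)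
      subst hij
      exact Equiv.Perm.SameCycle.refl _ _
    · simp only [maximalCycles, Finset.mem_filter, Finset.mem_univ, true_and]
      intro i j
      have hs : ∀ a : Fin (n + 2), finRotate (n + 2) a ≠ a := fun a => by
        have := support_finRotate (n := n)
        rw [← Equiv.Perm.mem_support, this]
        exact Finset.mem_univ a
      exact isCycle_finRotate.sameCycle (hs i) (hs j)
  exact ⟨fun _ => finRotate N, by simpa [cycleTuples] using fun _ => h⟩

/-! The expectation is computed by Fourier analysis on the symmetric group, where only hook
representations matter, and is then summed over `N = n + 1` by a beta integral. A hook vector is a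
function on `S_N` on which each Jucys–Murphy element, added one point at a time, acts as a scalar (a
content of the hook). Hence `∑ x ^ cycleCount g • g` acts by the content polynomial, and its linear
coefficient gives the action of the sum of maximal cycles. The determinants of `hookMatrix J` are
hook vectors. Expanding the determinant of `1 - s`, with row `0` replaced by ones, writes `n + 1`
times the indicator of maximal cycles as their signed sum. Applying the scalars gives
`expectedCyclePow_three`, a sum over the leg length `k` with weights `1 / n.choose k`. These weights
are beta integrals up to the factor `n + 1`, so the expectation over `n + 1` is the integral of
`cyclePoly x n` on `[0, 1]`. By Pascal's rule this polynomial satisfies a first-order recurrence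
with multiplier `t * (1 - t)`, whose inhomogeneous terms are binomial coefficients of `-x` and `x`.
The recurrence sums the generating function and bounds it for dominated convergence; reflecting `t`
in one term gives the stated integrand. -/

/-! ### Cycle counts -/

open Equiv Equiv.Perm Finset in
theorem cycleCount_eq {N : ℕ} (g : Perm (Fin N)) :
    cycleCount g + g.support.card = Multiset.card g.cycleType + N := by
  have h := g.support.card_le_univ
  simp only [Fintype.card_fin] at h
  simp only [cycleCount, parts_partition, Multiset.card_add, Multiset.card_replicate,
    Fintype.card_fin]
  omega

open Equiv Equiv.Perm Finset in
/-- Removing a moved point from its cycle increases the number of cycles by one. -/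
theorem cycleCount_swap_mul {N : ℕ} (g : Perm (Fin N)) {m : Fin N} (hm : g m ≠ m) :
    cycleCount (swap m (g m) * g) = cycleCount g + 1 := by
  set c := g.cycleOf m with hc
  set r := c⁻¹ * g with hr
  have hg : g = c * r := by simp [hr]
  have hcm : c m = g m := cycleOf_apply_self g m
  have hcyc : c.IsCycle := isCycle_cycleOf g hm
  have hdis : Disjoint c r := by
    have h := disjoint_mul_inv_of_mem_cycleFactorsFinset
      (cycleOf_mem_cycleFactorsFinset_iff.2 (mem_support.2 hm))
    have h2 : g * c⁻¹ = r := by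
      have hcomm : Commute c g := by
        have h1 := h.commute
        have : Commute (g.cycleOf m) (g * (g.cycleOf m)⁻¹ * g.cycleOf m) :=
          h1.symm.mul_right (Commute.refl _)
        simpa using this
      exact (hcomm.symm.inv_right).eq
    rw [← h2]; exact h.symm
  have h1 := cycleCount_eq g
  have h2 := cycleCount_eq (swap m (g m) * g)
  have hgt : g.cycleType = {c.support.card} + r.cycleType := by
    conv_lhs => rw [hg, hdis.cycleType_mul, hcyc.cycleType]
  have hgs : g.support.card = c.support.card + r.support.card := by
    conv_lhs => rw [hg, hdis.card_support_mul]
  rw [hgt, hgs] at h1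
  simp only [Multiset.card_add, Multiset.card_singleton] at h1
  -- A 2-cycle disappears from the cycle type and leaves two fixed points; a longer cycle stays a
  -- cycle and only loses `m`.
  by_cases hcc : c (c m) = m
  · have hsw : c = swap m (c m) := hcyc.eq_swap_of_apply_apply_eq_self (hcm ▸ hm) hcc
    have hr' : swap m (g m) * g = r := by
      rw [← hcm, ← hsw, hr]
      nth_rewrite 1 [hsw]
      conv_rhs => rw [hsw]
      simp
    have hcard : c.support.card = 2 := by
      rw [hsw]; exact card_support_swap (hcm ▸ hm.symm)
    rw [hr'] at h2 ⊢
    omega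
  · have hcyc' := hcyc.swap_mul (hcm ▸ hm) hcc
    have hsupp : (swap m (c m) * c).support = c.support \ {m} := support_swap_mul_eq c m hcc
    have hdis' : Disjoint (swap m (c m) * c) r := by
      rw [disjoint_iff_disjoint_support, hsupp]
      exact (disjoint_iff_disjoint_support.1 hdis).mono_left sdiff_subset
    have hg' : swap m (g m) * g = (swap m (c m) * c) * r := by
      rw [hcm, mul_assoc, ← hg]
    have hms : m ∈ c.support := mem_support.2 (hcm ▸ hm)
    have hcard : c.support.card = (swap m (c m) * c).support.card + 1 := by
      rw [hsupp, card_sdiff_of_subset (by simpa using hcm ▸ hm)]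
      have := card_pos.2 ⟨m, hms⟩
      simp; omega
    rw [hg', hdis'.cycleType_mul, hdis'.card_support_mul, hcyc'.cycleType] at h2
    simp only [Multiset.card_add, Multiset.card_singleton] at h2
    rw [hg']
    omega

open Equiv Equiv.Perm Finset in
theorem cycleCount_eq_one_iff {n : ℕ} (g : Perm (Fin (n + 1))) :
    cycleCount g = 1 ↔ g ∈ maximalCycles (n + 1) := by
  have h1 := cycleCount_eq g
  have hs := g.support.card_le_univ
  simp only [Fintype.card_fin] at hs
  simp only [maximalCycles, mem_filter, mem_univ, true_and]
  constructor
  · intro h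
    by_cases h0 : g = 1
    · subst h0
      have : n = 0 := by simp at h1; omega
      subst this
      intro i j
      rw [show i = j from Fin.ext (by omega)]
    · have hc := card_cycleType_pos.2 h0
      have hcyc : g.IsCycle := card_cycleType_eq_one.1 (by omega)
      have hu : g.support = univ := by
        rw [← card_eq_iff_eq_univ, Fintype.card_fin]; omega
      intro i j
      exact hcyc.sameCycle (mem_support.1 (hu ▸ mem_univ i)) (mem_support.1 (hu ▸ mem_univ j))
  · intro h
    by_cases h0 : g = 1
    · subst h0
      have : n = 0 := by
        by_contra hn
        have := (sameCycle_one.1 (h 0 (Fin.last n)))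
        simp [Fin.ext_iff] at this; omega
      subst this
      simp at h1; omega
    · have hfix : ∀ i, g i ≠ i := by
        intro i hi
        apply h0
        ext j
        obtain ⟨k, hk⟩ := h i j
        have : (g ^ k) i = i := zpow_apply_eq_self_of_apply_eq_self hi k
        rw [this] at hk
        subst hk
        simp [hi]
      have hu : g.support = univ := by
        ext i; simp [hfix i]
      have hcyc : g.IsCycle := ⟨0, hfix 0, fun j _ => h 0 j⟩
      have := card_cycleType_eq_one.2 hcyc
      rw [hu] at h1
      simp at h1
      omega

/-! ### Jucys–Murphy factorisation and hook vectors -/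

/-- The permutations moving only points of `S`. -/
def permsOn {N : ℕ} (S : Finset (Fin N)) : Finset (Equiv.Perm (Fin N)) :=
  Finset.univ.filter fun g => ∀ a ∉ S, g a = a

-- Coset decomposition by the image `i` of `m`; the term `i = m` is the subgroup itself.
open Equiv Equiv.Perm Finset in
theorem sum_permsOn_insert {N : ℕ} {M : Type*} [AddCommMonoid M] {S : Finset (Fin N)} {m : Fin N}
    (hm : m ∉ S) (f : Perm (Fin N) → M) :
    ∑ g ∈ permsOn (insert m S), f g =
      ∑ i ∈ insert m S, ∑ g ∈ permsOn S, f (swap m i * g) := by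
  rw [← sum_product']
  symm
  refine sum_bij' (fun p _ => swap m p.1 * p.2) (fun g _ => (g m, swap m (g m) * g)) ?_ ?_ ?_ ?_ ?_
  · rintro ⟨i, g⟩ h
    simp only [mem_product, permsOn, mem_filter, mem_univ, true_and] at h ⊢
    intro a ha
    rw [mul_apply, h.2 a (fun h' => ha (mem_insert_of_mem h')), swap_apply_of_ne_of_ne]
    · rintro rfl; simp at ha
    · rintro rfl; exact ha h.1
  · intro g h
    simp only [mem_product, permsOn, mem_filter, mem_univ, true_and] at h ⊢
    constructor
    · by_contra h'
      have := g.injective (h _ h')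
      rw [this] at h'
      simp at h'
    · intro a ha
      by_cases ham : a = m
      · subst ham; simp
      · have h3 := h a (by simp [ham, ha])
        rw [mul_apply, h3, swap_apply_of_ne_of_ne ham]
        intro h4
        exact ham (g.injective (h3.trans h4))
  · rintro ⟨i, g⟩ h
    simp only [mem_product, permsOn, mem_filter, mem_univ, true_and] at h
    simp [h.2 m hm]
  · intro g _
    simp
  · intros; rfl

open Equiv Equiv.Perm Finset Polynomial in
/-- Summing over permutations moving one more point multiplies the cycle-counting sum by a linear
factor, whenever the corresponding Jucys–Murphy element acts on `F` as the scalar `c`. -/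
theorem sum_permsOn_insert_eq {N : ℕ} {S : Finset (Fin N)} {m : Fin N} (hm : m ∉ S)
    (F : Perm (Fin N) → ℤ) (c : ℤ) (hF : ∀ s, ∑ i ∈ S, F (s * swap m i) = c * F s) (τ : ℤ[X])
    (hS : ∀ s, X ^ S.card * ∑ g ∈ permsOn S, X ^ cycleCount g * C (F (s * g)) =
      X ^ N * τ * C (F s)) (s : Perm (Fin N)) :
    X ^ (insert m S).card * ∑ g ∈ permsOn (insert m S), X ^ cycleCount g * C (F (s * g)) =
      X ^ N * (τ * (X + C c)) * C (F s) := by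
  rw [sum_permsOn_insert hm, sum_insert hm, card_insert_of_notMem hm]
  -- Since `g` fixes `m`, multiplying by `swap m i` merges two cycles. The lost factor `X` is
  -- supplied by the larger power in front, which keeps the identity inside `ℤ[X]`.
  have h1 : ∀ i ∈ S, X ^ (S.card + 1) *
      ∑ g ∈ permsOn S, X ^ cycleCount (swap m i * g) * C (F (s * (swap m i * g))) =
      X ^ N * τ * C (F (s * swap m i)) := by
    intro i hi
    rw [← hS (s * swap m i), mul_sum, mul_sum]
    refine sum_congr rfl fun g hg => ?_
    simp only [permsOn, mem_filter, mem_univ, true_and] at hg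
    have him : i ≠ m := by rintro rfl; exact hm hi
    have h := cycleCount_swap_mul (swap m i * g) (m := m) (by simp [hg m hm, him])
    simp only [mul_apply, hg m hm, swap_apply_left, swap_mul_self_mul] at h
    rw [h, pow_succ X (cycleCount _), mul_assoc s]
    ring
  rw [mul_add, mul_sum S, sum_congr rfl h1, ← mul_sum, ← map_sum, hF]
  simp only [swap_self]
  have h2 := hS s
  have h3 : (Equiv.refl (Fin N)) = (1 : Perm (Fin N)) := rfl
  simp only [h3, one_mul]
  rw [pow_succ', mul_assoc, h2, C_mul]
  ring

/-- Functions on the symmetric group behaving under right translation like the vector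
`∂ (e_{j₀} ∧ ⋯ ∧ e_{j_k})`, `J = {j₀, …, j_k}`, of the exterior algebra of the permutation
representation. -/
structure IsHookVector {N : ℕ} (J : Finset (Fin N)) (F : Equiv.Perm (Fin N) → ℤ) : Prop where
  anti : ∀ s, ∀ a ∈ J, ∀ b ∈ J, a ≠ b → F (s * Equiv.swap a b) = -F s
  inv : ∀ s, ∀ a ∉ J, ∀ b ∉ J, F (s * Equiv.swap a b) = F s
  contract : ∀ s, ∀ m ∉ J, ∑ i ∈ J, F (s * Equiv.swap m i) = F s

open Polynomial in
/-- The content polynomial of the hook with arm `l` and leg `k`. -/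
noncomputable def hookPolynomial (k l : ℕ) : ℤ[X] :=
  (∏ j ∈ Finset.range (k + 1), (X - C (j : ℤ))) * ∏ j ∈ Finset.range l, (X + C ((j : ℤ) + 1))

section
open Equiv Equiv.Perm Finset Polynomial
variable {N : ℕ} {J : Finset (Fin N)} {F : Perm (Fin N) → ℤ}

theorem permsOn_empty : permsOn (∅ : Finset (Fin N)) = {1} := by
  ext g
  simp [permsOn, Equiv.ext_iff]

theorem permsOn_univ : permsOn (univ : Finset (Fin N)) = univ := by
  ext g
  simp [permsOn]

theorem cycleCount_one : cycleCount (1 : Perm (Fin N)) = N := by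
  simpa using cycleCount_eq (1 : Perm (Fin N))

/-- Inside `J` every transposition acts by `-1`, so the successive contents are `0, -1, -2, …`: the
leg of the hook. -/
theorem IsHookVector.sum_permsOn_subset (hF : IsHookVector J F) (S : Finset (Fin N)) (hS : S ⊆ J)
    (s : Perm (Fin N)) :
    X ^ S.card * ∑ g ∈ permsOn S, X ^ cycleCount g * C (F (s * g)) =
      X ^ N * (∏ j ∈ range S.card, (X - C (j : ℤ))) * C (F s) := by
  induction S using Finset.induction_on generalizing s with
  | empty => simp [permsOn_empty, cycleCount_one]
  | insert m S hm ih =>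
    have hmJ : m ∈ J := hS (mem_insert_self m S)
    have hSJ : S ⊆ J := (subset_insert m S).trans hS
    rw [sum_permsOn_insert_eq hm F (-S.card) _ _ (ih hSJ), card_insert_of_notMem hm,
      prod_range_succ, C_neg, sub_eq_add_neg]
    intro s
    rw [sum_congr rfl fun i hi => hF.anti s m hmJ i (hSJ hi) (by rintro rfl; exact hm hi)]
    simp

/-- For a new point outside `J`, the transpositions with `S` contribute `S.card` by `inv` and those
with `J` contribute `1` by `contract`. The contents `1, 2, …` form the arm. -/
theorem IsHookVector.sum_permsOn_union (hF : IsHookVector J F) (k : ℕ) (hJ : J.card = k + 1)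
    (S : Finset (Fin N)) (hS : Disjoint S J) (s : Perm (Fin N)) :
    X ^ (S ∪ J).card * ∑ g ∈ permsOn (S ∪ J), X ^ cycleCount g * C (F (s * g)) =
      X ^ N * hookPolynomial k S.card * C (F s) := by
  induction S using Finset.induction_on generalizing s with
  | empty =>
    have h := hF.sum_permsOn_subset J subset_rfl s
    rw [empty_union, h, hJ]
    simp [hookPolynomial]
  | insert m S hm ih =>
    rw [disjoint_insert_left] at hS
    have hmU : m ∉ S ∪ J := by simp [hm, hS.1]
    rw [insert_union, sum_permsOn_insert_eq hmU F (S.card + 1) _ _ (ih hS.2),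
      card_insert_of_notMem hm]
    · simp only [hookPolynomial, prod_range_succ _ S.card, mul_assoc]
    · intro s
      rw [sum_union hS.2, hF.contract s m hS.1,
        sum_congr rfl fun i hi => hF.inv s m hS.1 i (disjoint_left.1 hS.2 hi)]
      simp
      ring

/-- The sum `∑ x ^ cycleCount g • g` acts on a hook vector as a scalar. -/
theorem IsHookVector.sum_univ (hF : IsHookVector J F) {k l : ℕ} (hJ : J.card = k + 1)
    (hN : N = k + 1 + l) (s : Perm (Fin N)) :
    ∑ g : Perm (Fin N), X ^ cycleCount g * C (F (s * g)) = hookPolynomial k l * C (F s) := by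
  have h := hF.sum_permsOn_union k hJ Jᶜ disjoint_compl_left s
  have hu : Jᶜ ∪ J = univ := by rw [union_comm, union_compl]
  have hc : Jᶜ.card = l := by rw [card_compl, Fintype.card_fin]; omega
  rw [hu, permsOn_univ, hc, card_univ, Fintype.card_fin, mul_assoc] at h
  exact mul_left_cancel₀ (pow_ne_zero _ X_ne_zero) h

/-- The factor with content `0` is `X`, so the linear coefficient is the product of the other
contents. Maximal cycles being the permutations with one cycle, this is the scalar by which their
sum acts. -/
theorem coeff_one_hookPolynomial (k l : ℕ) :
    (hookPolynomial k l).coeff 1 = (-1) ^ k * k.factorial * l.factorial := by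
  have h1 : ∀ k, (∏ j ∈ range k, (X - C ((j : ℤ) + 1))).coeff 0 = (-1) ^ k * (k.factorial : ℤ) := by
    intro k
    induction k with
    | zero => simp
    | succ k ih =>
      rw [prod_range_succ, mul_coeff_zero, ih, Nat.factorial_succ]
      simp
      ring
  have h2 : ∀ l, (∏ j ∈ range l, (X + C ((j : ℤ) + 1))).coeff 0 = (l.factorial : ℤ) := by
    intro l
    induction l with
    | zero => simp
    | succ k ih =>
      rw [prod_range_succ, mul_coeff_zero, ih, Nat.factorial_succ]
      simp
      ring
  have h3 : hookPolynomial k l = X * ((∏ j ∈ range k, (X - C ((j : ℤ) + 1))) *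
      ∏ j ∈ range l, (X + C ((j : ℤ) + 1))) := by
    rw [hookPolynomial, prod_range_succ']
    push_cast
    rw [C_0, sub_zero]
    ring
  rw [h3, coeff_X_mul, mul_coeff_zero, h1, h2]

end

section
open Equiv Equiv.Perm Finset Polynomial
variable {n : ℕ} {J : Finset (Fin (n + 1))} {F : Perm (Fin (n + 1)) → ℤ}

/-- The sum of all maximal cycles acts on a hook vector as a scalar. -/
theorem IsHookVector.sum_maximalCycles (hF : IsHookVector J F) {k l : ℕ} (hJ : J.card = k + 1)
    (hN : n = k + l) (s : Perm (Fin (n + 1))) :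
    ∑ g ∈ maximalCycles (n + 1), F (s * g) = (-1) ^ k * k.factorial * l.factorial * F s := by
  have h := congrArg (fun p => coeff p 1) (hF.sum_univ hJ (l := l) (by omega) s)
  simp only [finsetSum_coeff, coeff_mul_C, coeff_one_hookPolynomial, coeff_X_pow] at h
  rw [← h, ← sum_subset (subset_univ (maximalCycles (n + 1)))]
  · refine sum_congr rfl fun g hg => ?_
    simp [(cycleCount_eq_one_iff g).2 hg]
  · intro g _ hg
    have : 1 ≠ cycleCount g := fun h => hg ((cycleCount_eq_one_iff g).1 h.symm)
    simp [this]

end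

/-! ### Hook vectors as determinants, and the indicator of maximal cycles -/

/-- The identity matrix with the rows in `J` replaced by those of the permutation matrix of `s`, and
the row `0` replaced by ones. -/
def hookMatrix {n : ℕ} (J : Finset (Fin (n + 1))) (s : Equiv.Perm (Fin (n + 1))) :
    Matrix (Fin (n + 1)) (Fin (n + 1)) ℤ :=
  Matrix.of fun i j =>
    if i = 0 then 1 else if i ∈ J then (if s j = i then 1 else 0) else (if j = i then 1 else 0)

/-- The difference of the identity and the permutation matrix of `s`, with row `0` replaced by
ones. -/
def reducedDiffMatrix {n : ℕ} (s : Equiv.Perm (Fin (n + 1))) :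
    Matrix (Fin (n + 1)) (Fin (n + 1)) ℤ :=
  Matrix.of fun i j => if i = 0 then 1 else (if j = i then 1 else 0) - (if s j = i then 1 else 0)

section
open Equiv Equiv.Perm Finset Matrix
variable {n : ℕ}

theorem hookMatrix_zero_apply (J : Finset (Fin (n + 1))) (s : Perm (Fin (n + 1)))
    (j : Fin (n + 1)) : hookMatrix J s 0 j = 1 := by simp [hookMatrix]

theorem hookMatrix_apply_of_notMem {J : Finset (Fin (n + 1))} (s : Perm (Fin (n + 1)))
    {i : Fin (n + 1)} (hi : i ∉ insert 0 J) (j : Fin (n + 1)) :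
    hookMatrix J s i j = if j = i then 1 else 0 := by
  simp only [mem_insert, not_or] at hi
  simp [hookMatrix, hi]

theorem det_hookMatrix_one (J : Finset (Fin (n + 1))) : (hookMatrix J 1).det = 1 := by
  have : (hookMatrix J 1).BlockTriangular id := by
    intro i j hij
    have hi : i ≠ 0 := fun h => by simp [h] at hij
    have hji : j ≠ i := hij.ne
    simp [hookMatrix, hi, hji]
  rw [det_of_isUpperTriangular this]
  refine prod_eq_one fun i _ => ?_
  simp [hookMatrix]

/-- Right translation by a transposition permutes columns. Within `insert 0 J` this alone changes
the matrix; outside it, a matching row swap is needed to restore the identity rows, and the signs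
cancel. The contraction rule is Cramer's rule. -/
theorem isHookVector_det_hookMatrix (J : Finset (Fin (n + 1))) :
    IsHookVector (insert 0 J) fun s => (hookMatrix J s).det where
  anti s a ha b hb hab := by
    have : hookMatrix J (s * swap a b) = (hookMatrix J s).submatrix id (swap a b) := by
      ext i j
      by_cases hi : i ∈ insert 0 J
      · simp only [mem_insert] at hi
        by_cases h0 : i = 0
        · simp [hookMatrix, h0]
        · simp [hookMatrix, h0, hi.resolve_left h0]
          rfl
      · rw [submatrix_apply, id, hookMatrix_apply_of_notMem _ hi, hookMatrix_apply_of_notMem _ hi]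
        have h1 : i ≠ a := by rintro rfl; exact hi ha
        have h2 : i ≠ b := by rintro rfl; exact hi hb
        have : swap a b j = i ↔ j = i := by
          rw [← swap_apply_of_ne_of_ne h1 h2, (swap a b).injective.eq_iff]
          rw [swap_apply_of_ne_of_ne h1 h2]
        simp [this]
    simp only [this]
    rw [det_permute', sign_swap hab]
    simp
  inv s a ha b hb := by
    have : hookMatrix J (s * swap a b) =
        ((hookMatrix J s).submatrix id (swap a b)).submatrix (swap a b) id := by
      ext i j
      rw [submatrix_apply, submatrix_apply, id, id]
      by_cases hi : i ∈ insert 0 J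
      · have h1 : i ≠ a := by rintro rfl; exact ha hi
        have h2 : i ≠ b := by rintro rfl; exact hb hi
        rw [swap_apply_of_ne_of_ne h1 h2]
        simp only [mem_insert] at hi
        by_cases h0 : i = 0
        · simp [hookMatrix, h0]
        · simp [hookMatrix, h0, hi.resolve_left h0]
          rfl
      · have hi' : swap a b i ∉ insert 0 J := by
          by_cases h1 : i = a
          · simpa [h1] using hb
          · by_cases h2 : i = b
            · simpa [h2] using ha
            · rwa [swap_apply_of_ne_of_ne h1 h2]
        rw [hookMatrix_apply_of_notMem _ hi, hookMatrix_apply_of_notMem _ hi']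
        simp
    simp only [this]
    rw [det_permute, det_permute', ← mul_assoc, Int.cast_id, ← Units.val_mul,
      Int.units_mul_self, Units.val_one, one_mul]
  contract s m hm := by
    set M := hookMatrix J s with hM
    set v : Fin (n + 1) → ℤ := fun i => M i m - if i = m then 1 else 0 with hv
    have hm0 : m ≠ 0 := fun h => hm (by simp [h])
    -- Row `m` is a unit row, so subtracting its multiples clears column `m` elsewhere; this leaves
    -- `M` with column `i` replaced by `v`.
    have key : ∀ i ∈ insert 0 J, (hookMatrix J (s * swap m i)).det = cramer M v i := by
      intro i hi
      have him : i ≠ m := by rintro rfl; exact hm hi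
      rw [cramer_apply]
      refine det_eq_of_forall_row_eq_smul_add_const
        (fun a => if a = m then 0 else M a i - M a m) m (by simp) ?_
      intro a b
      have hBm : M.updateCol i v m b = if b = m then 1 else 0 := by
        by_cases hb : b = i
        · subst hb
          simp [hv, hM, hookMatrix_apply_of_notMem _ hm, him]
        · simp [hb, hM, hookMatrix_apply_of_notMem _ hm]
      rw [hBm]
      by_cases ha : a ∈ insert 0 J
      · have ham : a ≠ m := by rintro rfl; exact hm ha
        by_cases ha0 : a = 0
        · subst ha0
          by_cases hb : b = i <;> simp [hb, hv, hM, hookMatrix_zero_apply, hm0.symm]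
        · have haJ : a ∈ J := by simpa [ha0] using ha
          by_cases hb : b = i
          · subst hb
            simp [hv, hM, hookMatrix, ha0, haJ, ham, him]
          · by_cases hbm : b = m
            · subst hbm
              simp [hb, hM, hookMatrix, ha0, haJ, ham]
            · simp [hb, hbm, hM, hookMatrix, ha0, haJ, swap_apply_of_ne_of_ne hbm hb]
      · have hia : i ≠ a := by rintro rfl; exact ha hi
        rw [hookMatrix_apply_of_notMem _ ha]
        by_cases ham : a = m
        · subst ham
          simp [hBm]
        · by_cases hb : b = i
          · subst hb
            simp [hv, hM, hookMatrix_apply_of_notMem _ ha, ham, hia, him, Ne.symm ham]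
          · simp [hb, hM, hookMatrix_apply_of_notMem _ ha, ham, hia, Ne.symm ham]
    have hz : ∀ i ∉ insert 0 J, cramer M v i = 0 := by
      intro i hi
      have h := congrFun (mulVec_cramer M v) i
      have hvi : v i = 0 := by simp [hv, hM, hookMatrix_apply_of_notMem _ hi, eq_comm]
      simpa [mulVec, dotProduct, hM, hookMatrix_apply_of_notMem _ hi, hvi] using h
    -- Row `0` of `M` consists of ones and `v 0 = 1`, so this row of `M *ᵥ cramer M v = det M • v`
    -- is the required sum.
    have h0 := congrFun (mulVec_cramer M v) 0
    rw [sum_congr rfl key, sum_subset (subset_univ _) fun i _ hi => hz i hi]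
    simpa [mulVec, dotProduct, hM, hookMatrix_zero_apply, hv, hm0.symm] using h0

/-- Multilinearity in the rows: `J` records the rows where the permutation matrix is chosen, each
with sign `-1`. -/
theorem det_reducedDiffMatrix_eq_sum (s : Perm (Fin (n + 1))) :
    (reducedDiffMatrix s).det =
      ∑ J ∈ (univ.erase (0 : Fin (n + 1))).powerset, (-1) ^ J.card * (hookMatrix J s).det := by
  have h := (detRowAlternating (R := ℤ) (n := Fin (n + 1))).toMultilinearMap.map_add_univ
    (fun i j => if i = 0 then 0 else -(if s j = i then 1 else 0))
    (fun i j => if i = 0 then 1 else (if j = i then 1 else 0))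
  have h1 : reducedDiffMatrix s =
      (Matrix.of fun i j => if i = 0 then 0 else -(if s j = i then 1 else 0)) +
      Matrix.of fun i j => if i = 0 then 1 else (if j = i then 1 else 0) := by
    ext i j
    rw [Matrix.add_apply]
    by_cases hi : i = 0
    · simp [reducedDiffMatrix, hi]
    · simp only [reducedDiffMatrix, of_apply, hi, if_false]
      ring
  rw [h1]
  refine h.trans ?_
  symm
  rw [← sum_subset (subset_univ ((univ.erase (0 : Fin (n + 1))).powerset))]
  · refine sum_congr rfl fun J hJ => ?_
    have h0 : (0 : Fin (n + 1)) ∉ J := fun h => by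
      simpa using (mem_powerset.1 hJ) h
    have h2 := det_mul_column (fun i => if i ∈ J then (-1 : ℤ) else 1) (hookMatrix J s)
    rw [prod_ite] at h2
    simp only [prod_const, one_pow, mul_one, filter_mem_eq_inter, univ_inter] at h2
    rw [← h2]
    change det _ = det _
    congr 1
    ext i j
    by_cases hi : i ∈ J
    · have hi0 : i ≠ 0 := by rintro rfl; exact h0 hi
      simp only [of_apply, hookMatrix, hi, hi0, if_true, if_false, piecewise_eq_of_mem, neg_mul,
        one_mul]
    · simp [hookMatrix, hi]
  -- Row `0` is not split: choosing its first summand gives a zero row.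
  · intro J _ hJ
    have h0 : (0 : Fin (n + 1)) ∈ J := by
      by_contra h0
      apply hJ
      rw [mem_powerset]
      intro a ha
      rw [mem_erase]
      exact ⟨by rintro rfl; exact h0 ha, mem_univ a⟩
    change det _ = 0
    refine det_eq_zero_of_row_eq_zero 0 fun j => ?_
    simp [h0]

theorem det_reducedDiffMatrix_of_notMem {s : Perm (Fin (n + 1))}
    (hs : s ∉ maximalCycles (n + 1)) : (reducedDiffMatrix s).det = 0 := by
  classical
  have h1 : ∃ i, ¬ s.SameCycle 0 i := by
    by_contra! h
    apply hs
    simp only [maximalCycles, mem_filter, mem_univ, true_and]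
    exact fun i j => (h i).symm.trans (h j)
  obtain ⟨i, hi⟩ := h1
  -- The indicator of the points outside the cycle of `0` is `s`-invariant and ignores row `0`, so
  -- it is a left null vector.
  refine exists_vecMul_eq_zero_iff.1 ⟨fun a => if s.SameCycle 0 a then 0 else 1, ?_, ?_⟩
  · intro h
    have := congrFun h i
    simp [hi] at this
  · ext j
    have h2 : ∀ a, (if s.SameCycle 0 a then (0 : ℤ) else 1) * reducedDiffMatrix s a j =
        (if j = a then (if s.SameCycle 0 a then (0 : ℤ) else 1) else 0) -
        (if s j = a then (if s.SameCycle 0 a then (0 : ℤ) else 1) else 0) := by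
      intro a
      by_cases ha : s.SameCycle 0 a
      · simp [ha]
      · have ha0 : a ≠ 0 := by rintro rfl; exact ha (SameCycle.refl _ _)
        simp [ha, ha0, reducedDiffMatrix]
    simp only [vecMul, dotProduct, h2, sum_sub_distrib, sum_ite_eq, mem_univ, if_true]
    simp

/-- The matrix sends the all-ones vector to `n + 1` times the basis vector at `0`, so its
determinant is `n + 1` times the cofactor at `(0, 0)`. Ordering points along the cycle makes that
cofactor unitriangular. -/
theorem det_reducedDiffMatrix_of_mem {s : Perm (Fin (n + 1))}
    (hs : s ∈ maximalCycles (n + 1)) : (reducedDiffMatrix s).det = n + 1 := by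
  simp only [maximalCycles, mem_filter, mem_univ, true_and] at hs
  have hex : ∀ i, ∃ e : ℕ, (s ^ e) 0 = i := fun i => by
    obtain ⟨e, -, he⟩ := (hs 0 i).exists_pow_eq'
    exact ⟨e, he⟩
  set e : Fin (n + 1) → ℕ := fun i => Nat.find (hex i) with he
  have hes : ∀ i, (s ^ e i) 0 = i := fun i => Nat.find_spec (hex i)
  have hinj : Function.Injective e := fun i j h => by rw [← hes i, ← hes j, h]
  set B := reducedDiffMatrix s with hB
  have hone : B *ᵥ 1 = fun i => if i = 0 then ((n : ℤ) + 1) else 0 := by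
    ext i
    by_cases hi : i = 0
    · simp [hB, reducedDiffMatrix, mulVec, dotProduct, hi]
    · have : ∀ x, s x = i ↔ x = s⁻¹ i := fun x => by rw [eq_inv_iff_eq]
      simp [hB, reducedDiffMatrix, mulVec, dotProduct, hi, this]
  have hminor : B.adjugate 0 0 = 1 := by
    rw [adjugate_apply]
    have htri : (B.updateRow 0 (Pi.single 0 1)).BlockTriangular (OrderDual.toDual ∘ e) := by
      intro i j hij
      have hij' : e i < e j := hij
      by_cases hi : i = 0
      · have : j ≠ 0 := by rintro rfl; rw [hi] at hij'; exact lt_irrefl _ hij'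
        simp [hi, this]
      · have hji : j ≠ i := by rintro rfl; exact lt_irrefl _ hij'
        have hsj : s j ≠ i := by
          intro h
          have hpos : e i ≠ 0 := by
            intro h0
            have := hes i
            rw [h0] at this
            exact hi (by simpa using this.symm)
          obtain ⟨d, hd⟩ := Nat.exists_eq_succ_of_ne_zero hpos
          have h3 := hes i
          rw [hd, pow_succ', mul_apply, ← h] at h3
          have := Nat.find_min' (hex j) (s.injective h3)
          have : e j ≤ d := this
          omega
        simp [hB, reducedDiffMatrix, hi, hji, hsj]
    rw [htri.det]
    refine prod_eq_one fun a _ => ?_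
    have hblock : (B.updateRow 0 (Pi.single 0 1)).toSquareBlock (OrderDual.toDual ∘ e) a = 1 := by
      ext ⟨i, hi⟩ ⟨j, hj⟩
      have hij : j = i := hinj (OrderDual.toDual.injective (hj.trans hi.symm))
      subst hij
      rw [one_apply_eq]
      by_cases hj0 : j = 0
      · simp [toSquareBlock_def, hj0]
      · have hsj : s j ≠ j := by
          intro h
          have h0 : (s ^ e j) j = j := pow_apply_eq_self_of_apply_eq_self h _
          exact hj0 ((s ^ e j).injective (h0.trans (hes j).symm))
        simp [toSquareBlock_def, hB, reducedDiffMatrix, hj0, hsj]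
    rw [hblock, det_one]
  have h := congrFun (congrArg (fun M => M *ᵥ (1 : Fin (n + 1) → ℤ)) (adjugate_mul B)) 0
  simp only [← mulVec_mulVec, hone] at h
  rw [smul_mulVec, one_mulVec] at h
  simpa [mulVec, dotProduct, hminor] using h.symm

end

/-! ### The expectation as a sum over hooks -/

open Finset Polynomial in
theorem factorial_mul_choose (z : ℂ) (m : ℕ) :
    m.factorial * Ring.choose z m = ∏ j ∈ range m, (z - j) := by
  rw [← nsmul_eq_mul, ← Ring.descPochhammer_eq_factorial_smul_choose]
  induction m with
  | zero => simp
  | succ m ih =>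
    rw [descPochhammer_succ_right, smeval_mul, ih, prod_range_succ]
    simp [smeval_sub, smeval_natCast]

open Finset Polynomial in
theorem aeval_hookPolynomial {n k : ℕ} (hk : k ≤ n) (x : ℂ) :
    aeval x (hookPolynomial k (n - k)) =
      (n + 1).factorial * Ring.choose (x + n - k) (n + 1) := by
  rw [factorial_mul_choose]
  obtain ⟨l, rfl⟩ := Nat.exists_eq_add_of_le hk
  rw [show k + l + 1 = l + (k + 1) by ring, prod_range_add, hookPolynomial, map_mul, map_prod,
    map_prod, mul_comm, Nat.add_sub_cancel_left]
  congr 1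
  · rw [← prod_range_reflect]
    refine prod_congr rfl fun j hj => ?_
    have := mem_range.1 hj
    rw [show l - 1 - j = l - (j + 1) by omega]
    push_cast [show j + 1 ≤ l from this]
    simp
    ring
  · refine prod_congr rfl fun j hj => ?_
    simp
    ring

section
open Equiv Equiv.Perm Finset Polynomial
variable {n : ℕ}

/-- For `J = ∅` the hook vector is the constant `1`, so the scalar of the sum of maximal cycles is
their number. -/
theorem card_maximalCycles (n : ℕ) : (maximalCycles (n + 1)).card = n.factorial := by
  have h := (isHookVector_det_hookMatrix (∅ : Finset (Fin (n + 1)))).sum_maximalCycles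
    (k := 0) (l := n) (by simp) (by simp) 1
  have h1 : ∀ s : Perm (Fin (n + 1)), hookMatrix ∅ s = hookMatrix ∅ 1 := fun s => by
    ext i j; simp [hookMatrix]
  simp only [h1, det_hookMatrix_one] at h
  simp at h
  exact_mod_cast h

theorem inv_mem_maximalCycles {s : Perm (Fin (n + 1))} (hs : s ∈ maximalCycles (n + 1)) :
    s⁻¹ ∈ maximalCycles (n + 1) := by
  simp only [maximalCycles, mem_filter, mem_univ, true_and, sameCycle_inv] at hs ⊢
  exact hs

/-- With `a`, `b` the inverses of the second and first cycles and `g` the product, the third cycle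
is `a * b * g`; its maximality becomes an indicator to expand in hook vectors. -/
theorem sum_cycleTuples_three {M : Type*} [AddCommMonoid M] (f : Perm (Fin (n + 1)) → M) :
    ∑ s ∈ cycleTuples 3 (n + 1), f (tupleProduct s) =
      ∑ a ∈ maximalCycles (n + 1), ∑ b ∈ maximalCycles (n + 1), ∑ g : Perm (Fin (n + 1)),
        if a * b * g ∈ maximalCycles (n + 1) then f g else 0 := by
  have h1 : ∀ a b : Perm (Fin (n + 1)), ∑ g : Perm (Fin (n + 1)),
      (if a * b * g ∈ maximalCycles (n + 1) then f g else 0) =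
      ∑ c ∈ maximalCycles (n + 1), f (b⁻¹ * a⁻¹ * c) := by
    intro a b
    rw [← sum_filter]
    refine sum_bij' (fun g _ => a * b * g) (fun c _ => b⁻¹ * a⁻¹ * c) ?_ ?_ ?_ ?_ ?_
    · intro g hg; simpa using hg
    · intro c hc; simpa [mul_assoc] using hc
    · intro g _; simp [mul_assoc]
    · intro c _; simp [mul_assoc]
    · intro g _; simp [mul_assoc]
  simp only [h1]
  simp only [← sum_product']
  refine sum_bij' (fun s _ => ((s 1)⁻¹, (s 0)⁻¹, s 2)) (fun p _ => ![p.2.1⁻¹, p.1⁻¹, p.2.2])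
    ?_ ?_ ?_ ?_ ?_
  · intro s hs
    simp only [cycleTuples, Fintype.mem_piFinset] at hs
    simp [inv_mem_maximalCycles, hs]
  · rintro ⟨a, b, c⟩ h
    simp only [mem_product] at h
    simp [cycleTuples, Fin.forall_fin_succ, inv_mem_maximalCycles, h]
  · intro s _
    ext i : 1
    fin_cases i <;> simp
  · rintro ⟨a, b, c⟩ _
    simp
  · intro s _
    simp [tupleProduct, List.ofFn_succ, mul_assoc]

theorem succ_mul_ite_mem_maximalCycles (s : Perm (Fin (n + 1))) :
    ((n : ℤ) + 1) * (if s ∈ maximalCycles (n + 1) then 1 else 0) =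
      ∑ J ∈ (univ.erase (0 : Fin (n + 1))).powerset, (-1) ^ J.card * (hookMatrix J s).det := by
  rw [← det_reducedDiffMatrix_eq_sum]
  by_cases h : s ∈ maximalCycles (n + 1)
  · simp [h, det_reducedDiffMatrix_of_mem h]
  · simp [h, det_reducedDiffMatrix_of_notMem h]

theorem IsHookVector.sum_pow_cycleCount {J : Finset (Fin (n + 1))} {F : Perm (Fin (n + 1)) → ℤ}
    (hF : IsHookVector J F) {k : ℕ} (hJ : J.card = k + 1) (s : Perm (Fin (n + 1))) (x : ℂ) :
    ∑ g : Perm (Fin (n + 1)), x ^ cycleCount g * (F (s * g) : ℂ) =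
      (n + 1).factorial * Ring.choose (x + n - k) (n + 1) * F s := by
  have hk : k ≤ n := by
    have := J.card_le_univ
    rw [Fintype.card_fin] at this
    omega
  have h := congrArg (aeval x) (hF.sum_univ hJ (l := n - k) (by omega) s)
  rw [map_mul, aeval_hookPolynomial hk] at h
  simpa using h

/-- The sums over `g`, `b`, `a` are evaluated in turn, each as a scalar; the signs from the two
maximal-cycle sums cancel. -/
theorem sum_sum_hookMatrix {J : Finset (Fin (n + 1))} (h0 : 0 ∉ J) (x : ℂ) :
    ∑ a ∈ maximalCycles (n + 1), ∑ b ∈ maximalCycles (n + 1), ∑ g : Perm (Fin (n + 1)),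
      x ^ cycleCount g * ((hookMatrix J (a * b * g)).det : ℂ) =
    (n + 1).factorial * Ring.choose (x + n - J.card) (n + 1) *
      (J.card.factorial * (n - J.card).factorial) ^ 2 := by
  have hF := isHookVector_det_hookMatrix J
  have hJ := card_insert_of_notMem h0
  have hk : J.card ≤ n := by
    have := (insert 0 J).card_le_univ
    rw [Fintype.card_fin] at this
    omega
  have hb := fun a => hF.sum_maximalCycles hJ (l := n - J.card) (by omega) a
  have ha := hb 1
  simp only [one_mul, det_hookMatrix_one] at ha
  simp only [hF.sum_pow_cycleCount hJ, ← mul_sum, ← Int.cast_sum, hb, ha]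
  push_cast
  have : ((-1 : ℂ) ^ J.card) ^ 2 = 1 := by rw [← pow_mul, mul_comm, pow_mul]; simp
  linear_combination ((n + 1).factorial * Ring.choose (x + n - J.card) (n + 1) *
      (J.card.factorial * (n - J.card).factorial : ℂ) ^ 2) * this

theorem expectedCyclePow_three (n : ℕ) (x : ℂ) :
    expectedCyclePow 3 (n + 1) x = ∑ k ∈ range (n + 1),
      (-1) ^ k * Ring.choose (x + n - k) (n + 1) / n.choose k := by
  have h1 := sum_cycleTuples_three (n := n) (fun g => x ^ cycleCount g)
  have h2 : ∀ a b g : Perm (Fin (n + 1)),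
      ((n : ℂ) + 1) * (if a * b * g ∈ maximalCycles (n + 1) then x ^ cycleCount g else 0) =
      ∑ J ∈ (univ.erase (0 : Fin (n + 1))).powerset,
        (-1) ^ J.card * (x ^ cycleCount g * ((hookMatrix J (a * b * g)).det : ℂ)) := by
    intro a b g
    have := congrArg (fun z : ℤ => (z : ℂ) * x ^ cycleCount g)
      (succ_mul_ite_mem_maximalCycles (a * b * g))
    push_cast at this
    rw [sum_mul, mul_assoc, ite_mul, one_mul, zero_mul] at this
    rw [this]
    exact sum_congr rfl fun J _ => by rw [Int.cast_det]; ring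
  have h3 : ((n : ℂ) + 1) * ∑ s ∈ cycleTuples 3 (n + 1), x ^ cycleCount (tupleProduct s) =
      ∑ J ∈ (univ.erase (0 : Fin (n + 1))).powerset, (-1) ^ J.card *
        ((n + 1).factorial * Ring.choose (x + n - J.card) (n + 1) *
          (J.card.factorial * (n - J.card).factorial) ^ 2) := by
    rw [h1]
    simp only [mul_sum, h2]
    simp only [sum_comm (t := (univ.erase (0 : Fin (n + 1))).powerset), ← mul_sum]
    refine sum_congr rfl fun J hJ => ?_
    rw [sum_sum_hookMatrix]
    intro h
    simpa using (mem_powerset.1 hJ) h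
  rw [sum_powerset_apply_card (fun k => (-1 : ℂ) ^ k *
        ((n + 1).factorial * Ring.choose (x + n - k) (n + 1) *
          (k.factorial * (n - k).factorial) ^ 2)), card_erase_of_mem (mem_univ _), card_univ,
    Fintype.card_fin, Nat.add_sub_cancel] at h3
  rw [expectedCyclePow, expect_eq_sum_div_card]
  have hcard : ((cycleTuples 3 (n + 1)).card : ℂ) = (n.factorial : ℂ) ^ 3 := by
    simp [cycleTuples, Fintype.card_piFinset, card_maximalCycles]
  have hn : (n : ℂ) + 1 ≠ 0 := by exact_mod_cast n.succ_ne_zero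
  have hfac : (n.factorial : ℂ) ≠ 0 := by exact_mod_cast n.factorial_ne_zero
  rw [hcard, div_eq_iff (pow_ne_zero _ hfac)]
  apply mul_left_cancel₀ hn
  rw [h3, sum_mul, mul_sum]
  refine sum_congr rfl fun k hk => ?_
  have hkn : k ≤ n := by have := mem_range.1 hk; omega
  have hch : (n.choose k : ℂ) ≠ 0 := by exact_mod_cast (Nat.choose_pos hkn).ne'
  have hcf : (n.choose k : ℂ) * k.factorial * (n - k).factorial = n.factorial := by
    exact_mod_cast Nat.choose_mul_factorial_mul_factorial hkn
  rw [nsmul_eq_mul, ← hcf, Nat.factorial_succ]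
  push_cast
  rw [← hcf]
  field_simp

end

/-! ### Beta integrals and the recurrence -/

/-- The polynomial in `t` whose integral over `[0, 1]` is `expectedCyclePow 3 (n + 1) x / (n + 1)`. -/
noncomputable def cyclePoly (x : ℂ) (n : ℕ) (t : ℂ) : ℂ :=
  ∑ k ∈ Finset.range (n + 1), (-1) ^ k * Ring.choose (x + n - k) (n + 1) * (t ^ k * (1 - t) ^ (n - k))

open Complex in
theorem integral_pow_mul_one_sub_pow (k l : ℕ) :
    ∫ t in (0 : ℝ)..1, (t : ℂ) ^ k * (1 - (t : ℂ)) ^ l =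
      k.factorial * l.factorial / (k + l + 1).factorial := by
  have h := Gamma_mul_Gamma_eq_betaIntegral (s := k + 1) (t := l + 1)
    (by simp; positivity) (by simp; positivity)
  rw [Gamma_nat_eq_factorial, Gamma_nat_eq_factorial,
    show (k : ℂ) + 1 + (l + 1) = ((k + l + 1 : ℕ) : ℂ) + 1 by push_cast; ring,
    Gamma_nat_eq_factorial, betaIntegral] at h
  simp only [add_sub_cancel_right, cpow_natCast] at h
  rw [h, mul_div_cancel_left₀]
  exact_mod_cast Nat.factorial_ne_zero _

theorem continuous_cyclePoly (x : ℂ) (n : ℕ) : Continuous (cyclePoly x n) := by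
  unfold cyclePoly
  fun_prop

open Finset in
theorem integral_cyclePoly (x : ℂ) (n : ℕ) :
    ∫ t in (0 : ℝ)..1, cyclePoly x n t = expectedCyclePow 3 (n + 1) x / (n + 1) := by
  simp only [cyclePoly]
  rw [intervalIntegral.integral_finsetSum fun k _ => Continuous.intervalIntegrable (by fun_prop) _ _]
  rw [expectedCyclePow_three, sum_div]
  refine sum_congr rfl fun k hk => ?_
  have hkn : k ≤ n := by have := mem_range.1 hk; omega
  rw [intervalIntegral.integral_const_mul, integral_pow_mul_one_sub_pow,
    Nat.add_sub_cancel' hkn, Nat.factorial_succ]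
  have hch : (n.choose k : ℂ) ≠ 0 := by exact_mod_cast (Nat.choose_pos hkn).ne'
  have hn : (n : ℂ) + 1 ≠ 0 := by exact_mod_cast n.succ_ne_zero
  have hfac : (n.factorial : ℂ) ≠ 0 := by exact_mod_cast n.factorial_ne_zero
  have hcf : (n.choose k : ℂ) * k.factorial * (n - k).factorial = n.factorial := by
    exact_mod_cast Nat.choose_mul_factorial_mul_factorial hkn
  push_cast
  field_simp
  rw [← hcf]
  ring

theorem choose_neg_mul_neg_pow (x u : ℂ) (m : ℕ) :
    Ring.choose (-x) m * (-u) ^ m = Ring.choose (x + m - 1) m * u ^ m := by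
  rw [Ring.choose_neg]
  rcases m.even_or_odd with h | h
  · rw [Int.negOnePow_even _ (by exact_mod_cast h), h.neg_pow, one_smul]
  · rw [Int.negOnePow_odd _ (by exact_mod_cast h), h.neg_pow, Units.neg_smul, one_smul]
    ring

theorem cyclePoly_zero (x t : ℂ) :
    cyclePoly x 0 t = Ring.choose (-x) 1 * (-(1 - t)) ^ 1 - Ring.choose x 1 * (-t) ^ 1 := by
  simp [cyclePoly]
  ring

-- Splitting `1 = (1 - t) + t` and shifting the index in the first part aligns the powers, so
-- Pascal's rule lowers the binomials. The two unmatched end terms are the binomial terms on the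
-- right.
open Finset in
theorem cyclePoly_succ (x t : ℂ) (n : ℕ) :
    cyclePoly x (n + 1) t = t * (1 - t) * cyclePoly x n t +
      (Ring.choose (-x) (n + 2) * (-(1 - t)) ^ (n + 2) - Ring.choose x (n + 2) * (-t) ^ (n + 2)) := by
  have hu : cyclePoly x (n + 1) t = (1 - t) * cyclePoly x (n + 1) t + t * cyclePoly x (n + 1) t := by
    ring
  have h1 : (1 - t) * cyclePoly x (n + 1) t =
      ∑ k ∈ range (n + 1), -((-1) ^ k * Ring.choose (x + n - k) (n + 2) *
        (t ^ (k + 1) * (1 - t) ^ (n + 1 - k))) +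
      Ring.choose (x + n + 1) (n + 2) * (1 - t) ^ (n + 2) := by
    rw [cyclePoly, sum_range_succ', mul_add, mul_sum]
    congr 1
    · refine sum_congr rfl fun k hk => ?_
      have hkn : k ≤ n := by have := mem_range.1 hk; omega
      rw [show n + 1 - (k + 1) = n - k by omega, show n + 1 - k = n - k + 1 by omega]
      push_cast
      rw [show x + (n + 1) - (k + 1) = x + n - k by ring]
      ring
    · simp [add_assoc]
      ring
  have h2 : t * cyclePoly x (n + 1) t =
      ∑ k ∈ range (n + 1), (-1) ^ k * Ring.choose (x + n - k + 1) (n + 2) *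
        (t ^ (k + 1) * (1 - t) ^ (n + 1 - k)) + -(Ring.choose x (n + 2) * (-t) ^ (n + 2)) := by
    rw [cyclePoly, sum_range_succ, mul_add, mul_sum]
    congr 1
    · refine sum_congr rfl fun k hk => ?_
      push_cast
      rw [show x + (n + 1) - k = x + n - k + 1 by ring]
      ring
    · rw [neg_pow t]
      simp
      ring
  rw [hu, h1, h2, choose_neg_mul_neg_pow, cyclePoly, mul_sum]
  push_cast
  rw [show x + (n + 2) - 1 = x + n + 1 by ring]
  have h3 : ∑ k ∈ range (n + 1), -((-1) ^ k * Ring.choose (x + n - k) (n + 2) *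
        (t ^ (k + 1) * (1 - t) ^ (n + 1 - k))) +
      ∑ k ∈ range (n + 1), (-1) ^ k * Ring.choose (x + n - k + 1) (n + 2) *
        (t ^ (k + 1) * (1 - t) ^ (n + 1 - k)) =
      ∑ k ∈ range (n + 1), t * (1 - t) *
        ((-1) ^ k * Ring.choose (x + n - k) (n + 1) * (t ^ k * (1 - t) ^ (n - k))) := by
    rw [← sum_add_distrib]
    refine sum_congr rfl fun k hk => ?_
    have hkn : k ≤ n := by have := mem_range.1 hk; omega
    rw [Ring.choose_succ_succ, show n + 1 - k = n - k + 1 by omega]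
    ring
  rw [← h3]
  ring

/-! ### Bounds and the generating function -/

open Finset in
theorem norm_choose_le_one {x : ℂ} (hx : ‖x‖ ≤ 1) (m : ℕ) : ‖Ring.choose x m‖ ≤ 1 := by
  have h := congrArg norm (factorial_mul_choose x m)
  rw [norm_mul, norm_prod, Complex.norm_natCast] at h
  have h2 : ∏ j ∈ range m, ‖x - j‖ ≤ m.factorial := by
    rw [← prod_range_add_one_eq_factorial]
    push_cast
    refine prod_le_prod (fun _ _ => norm_nonneg _) fun j _ => ?_
    refine (norm_sub_le _ _).trans ?_
    rw [Complex.norm_natCast]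
    linarith
  have h3 : (0 : ℝ) < m.factorial := by exact_mod_cast m.factorial_pos
  rw [← h] at h2
  exact le_of_mul_le_mul_left (by linarith) h3

theorem norm_choose_mul_pow_le_one {x z : ℂ} (hx : ‖x‖ ≤ 1) (hz : ‖z‖ ≤ 1) (m : ℕ) :
    ‖Ring.choose x m * z ^ m‖ ≤ 1 := by
  rw [norm_mul, norm_pow]
  exact mul_le_one₀ (norm_choose_le_one hx m) (by positivity) (pow_le_one₀ (norm_nonneg _) hz)

theorem norm_ofReal_mul_one_sub_le {t : ℝ} (ht : t ∈ Set.Icc (0 : ℝ) 1) :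
    ‖(t : ℂ) * (1 - t)‖ ≤ 1 / 4 := by
  have : (t : ℂ) * (1 - t) = ((t * (1 - t) : ℝ) : ℂ) := by push_cast; ring
  rw [this, Complex.norm_real, Real.norm_of_nonneg (mul_nonneg ht.1 (by linarith [ht.2]))]
  nlinarith [sq_nonneg (t - 1 / 2)]

theorem norm_one_sub_ofReal_le {t : ℝ} (ht : t ∈ Set.Icc (0 : ℝ) 1) : ‖(1 : ℂ) - t‖ ≤ 1 := by
  have : (1 : ℂ) - t = ((1 - t : ℝ) : ℂ) := by push_cast; ring
  rw [this, Complex.norm_real, Real.norm_of_nonneg (by linarith [ht.2])]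
  linarith [ht.1]

theorem norm_ofReal_le {t : ℝ} (ht : t ∈ Set.Icc (0 : ℝ) 1) : ‖(t : ℂ)‖ ≤ 1 := by
  rw [Complex.norm_real, Real.norm_of_nonneg ht.1]
  exact ht.2

theorem norm_cyclePoly_le {x : ℂ} (hx : ‖x‖ ≤ 1) {t : ℝ} (ht : t ∈ Set.Icc (0 : ℝ) 1) (n : ℕ) :
    ‖cyclePoly x n t‖ ≤ 3 := by
  have hd : ∀ m, ‖Ring.choose (-x) m * (-(1 - (t : ℂ))) ^ m - Ring.choose x m * (-(t : ℂ)) ^ m‖ ≤ 2 := by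
    intro m
    refine (norm_sub_le _ _).trans ?_
    have h1 := norm_choose_mul_pow_le_one (x := -x) (z := -(1 - (t : ℂ))) (by simpa using hx)
      (by rw [norm_neg]; exact norm_one_sub_ofReal_le ht) m
    have h2 := norm_choose_mul_pow_le_one (z := -(t : ℂ)) hx
      (by rw [norm_neg]; exact norm_ofReal_le ht) m
    linarith
  induction n with
  | zero =>
    rw [cyclePoly_zero]
    linarith [hd 1]
  | succ n ih =>
    rw [cyclePoly_succ]
    refine (norm_add_le _ _).trans ?_
    rw [norm_mul]
    -- The bound `3` reproduces itself because `3 / 4 + 2 ≤ 3`.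
    have := mul_le_mul (norm_ofReal_mul_one_sub_le ht) ih (norm_nonneg _) (by norm_num)
    linarith [hd (n + 2)]

theorem hasSum_choose_mul_pow (a : ℂ) {z : ℂ} (hz : ‖z‖ < 1) :
    HasSum (fun m => Ring.choose a m * z ^ m) ((1 + z) ^ a) := by
  have h := (Complex.one_add_cpow_hasFPowerSeriesOnBall_zero (a := a)).hasSum (y := z)
    (by
      rw [← ENNReal.ofReal_one, Metric.eball_ofReal]
      simpa using hz)
  simpa only [binomialSeries_apply, List.ofFn_const, List.prod_replicate, smul_eq_mul, zero_add]
    using h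

theorem hasSum_cyclePoly {x y : ℂ} (hx : ‖x‖ ≤ 1) (hy : ‖y‖ < 1) {t : ℝ}
    (ht : t ∈ Set.Icc (0 : ℝ) 1) :
    HasSum (fun n => cyclePoly x n t * y ^ (n + 1))
      (((1 - y * (1 - t)) ^ (-x) - (1 - y * t) ^ x) / (1 - y * t * (1 - t))) := by
  set q : ℕ → ℂ := fun n => cyclePoly x n t * y ^ (n + 1) with hq
  set d : ℕ → ℂ := fun m => Ring.choose (-x) m * (-(y * (1 - t))) ^ m -
    Ring.choose x m * (-(y * t)) ^ m with hd
  have hsum : HasSum d ((1 - y * (1 - t)) ^ (-x) - (1 - y * t) ^ x) := by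
    have h1 := hasSum_choose_mul_pow (-x) (z := -(y * (1 - t))) (by
      rw [norm_neg, norm_mul]
      exact (mul_le_of_le_one_right (norm_nonneg _) (norm_one_sub_ofReal_le ht)).trans_lt hy)
    have h2 := hasSum_choose_mul_pow x (z := -(y * t)) (by
      rw [norm_neg, norm_mul]
      exact (mul_le_of_le_one_right (norm_nonneg _) (norm_ofReal_le ht)).trans_lt hy)
    simpa only [← sub_eq_add_neg] using h1.sub h2
  have hd0 : d 0 = 0 := by simp [hd]
  have hqs : Summable q := by
    refine Summable.of_norm_bounded (g := fun n => 3 * ‖y‖ ^ (n + 1)) ?_ fun n => ?_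
    · exact ((summable_geometric_of_lt_one (norm_nonneg _) hy).comp_injective
        (add_left_injective 1)).mul_left 3
    · rw [hq, norm_mul, norm_pow]
      exact mul_le_mul_of_nonneg_right (norm_cyclePoly_le hx ht n) (by positivity)
  obtain ⟨S, hS⟩ := hqs
  have hden : 1 - y * t * (1 - t) ≠ 0 := by
    intro h
    have h1 : y * (t * (1 - t)) = 1 := by linear_combination -h
    have h2 := congrArg norm h1
    rw [norm_mul, norm_one] at h2
    have h3 := mul_le_mul hy.le (norm_ofReal_mul_one_sub_le ht) (norm_nonneg _) zero_le_one
    linarith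
  have hq0 : q 0 = d 1 := by
    simp only [hq, hd, cyclePoly_zero]
    ring
  -- The recurrence multiplied by `y ^ (n + 2)`. The sum of `d` starts effectively at index `1`, the
  -- constant terms of the two binomial series cancelling.
  have hqsucc : ∀ n, q (n + 1) - y * t * (1 - t) * q n = d (n + 2) := by
    intro n
    simp only [hq, hd, cyclePoly_succ, neg_mul_eq_mul_neg, mul_pow]
    ring
  have h1 : HasSum (fun n => q (n + 1)) (S - q 0) := by
    simpa using (hasSum_nat_add_iff' 1).2 hS
  have h2 := h1.sub (hS.mul_left (y * t * (1 - t)))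
  simp only [hqsucc] at h2
  have h3 := (hasSum_nat_add_iff' 2).2 hsum
  have h4 := h2.unique h3
  simp only [Finset.sum_range_succ, Finset.sum_range_zero, hd0, hq0] at h4
  rw [show ((1 - y * (1 - t)) ^ (-x) - (1 - y * t) ^ x) / (1 - y * t * (1 - t)) = S by
    rw [div_eq_iff hden]; linear_combination -h4]
  exact hS

theorem hasSum_integral_cyclePoly {x y : ℂ} (hx : ‖x‖ ≤ 1) (hy : ‖y‖ < 1) :
    HasSum (fun n : ℕ => y ^ (n + 1) / ((n + 1 : ℕ) : ℂ) * expectedCyclePow 3 (n + 1) x)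
      (∫ t in (0 : ℝ)..1,
        ((1 - y * (1 - t)) ^ (-x) - (1 - y * t) ^ x) / (1 - y * t * (1 - t))) := by
  have hI : ∀ t, t ∈ Set.uIoc (0 : ℝ) 1 → t ∈ Set.Icc (0 : ℝ) 1 := fun t ht => by
    rw [Set.uIoc_of_le zero_le_one] at ht
    exact Set.Ioc_subset_Icc_self ht
  have h := intervalIntegral.hasSum_integral_of_dominated_convergence
    (μ := MeasureTheory.volume) (a := 0) (b := 1)
    (F := fun n (t : ℝ) => cyclePoly x n t * y ^ (n + 1))
    (f := fun t : ℝ => ((1 - y * (1 - t)) ^ (-x) - (1 - y * t) ^ x) / (1 - y * t * (1 - t)))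
    (fun n _ => 3 * ‖y‖ ^ (n + 1))
    (fun n => (((continuous_cyclePoly x n).comp Complex.continuous_ofReal).mul
      continuous_const).aestronglyMeasurable)
    (fun n => .of_forall fun t ht => by
      rw [norm_mul, norm_pow]
      exact mul_le_mul_of_nonneg_right (norm_cyclePoly_le hx (hI t ht) n) (by positivity))
    (.of_forall fun t _ => ((summable_geometric_of_lt_one (norm_nonneg _) hy).comp_injective
        (add_left_injective 1)).mul_left 3)
    (by simp)
    (.of_forall fun t ht => hasSum_cyclePoly hx hy (hI t ht))
  have hterm : (fun n : ℕ => y ^ (n + 1) / ((n + 1 : ℕ) : ℂ) * expectedCyclePow 3 (n + 1) x) =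
      fun n => ∫ t in (0 : ℝ)..1, cyclePoly x n t * y ^ (n + 1) := by
    funext n
    rw [intervalIntegral.integral_mul_const, integral_cyclePoly]
    push_cast
    ring
  rw [hterm]
  exact h

theorem continuousOn_cpow_div {y : ℂ} (hy : ‖y‖ < 1) (a : ℂ) :
    ContinuousOn (fun t : ℝ => (1 - y * (1 - t)) ^ a / (1 - y * t * (1 - t)))
      (Set.Icc (0 : ℝ) 1) := by
  refine ContinuousOn.div (ContinuousOn.cpow_const (by fun_prop) ?_) (by fun_prop) ?_
  · intro t ht
    rw [sub_eq_add_neg]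
    apply Complex.mem_slitPlane_of_norm_lt_one
    rw [norm_neg, norm_mul]
    exact (mul_le_of_le_one_right (norm_nonneg _) (norm_one_sub_ofReal_le ht)).trans_lt hy
  · intro t ht h
    have h1 : y * (t * (1 - t)) = 1 := by linear_combination -h
    have h2 := congrArg norm h1
    rw [norm_mul, norm_one] at h2
    have h3 := mul_le_mul hy.le (norm_ofReal_mul_one_sub_le ht) (norm_nonneg _) zero_le_one
    linarith

theorem mainTheorem8 (x y : ℂ) (hx : ‖x‖ ≤ 1) (hy : ‖y‖ < 1) :
    IntervalIntegrable
      (fun t : ℝ => ((1 - y * (1 - t)) ^ (-x) - (1 - y * (1 - t)) ^ x) / (1 - y * t * (1 - t)))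
      MeasureTheory.volume 0 1 ∧
    HasSum (fun n : ℕ => y ^ (n + 1) / ((n + 1 : ℕ) : ℂ) * expectedCyclePow 3 (n + 1) x)
      (∫ t in (0 : ℝ)..1,
        ((1 - y * (1 - t)) ^ (-x) - (1 - y * (1 - t)) ^ x) / (1 - y * t * (1 - t))) := by
  have hint : ∀ a : ℂ, IntervalIntegrable
      (fun t : ℝ => (1 - y * (1 - t)) ^ a / (1 - y * t * (1 - t))) MeasureTheory.volume 0 1 :=
    fun a => ContinuousOn.intervalIntegrable
      (by simpa [Set.uIcc_of_le] using continuousOn_cpow_div hy a)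
  -- The denominator is symmetric under `t ↦ 1 - t`, so this reflection alters only the numerator;
  -- both terms are integrable separately.
  have hrefl : ∀ t : ℝ, (1 - y * t) ^ x / (1 - y * t * (1 - t)) =
      (1 - y * (1 - ((1 - t : ℝ) : ℂ))) ^ x /
        (1 - y * ((1 - t : ℝ) : ℂ) * (1 - ((1 - t : ℝ) : ℂ))) := by
    intro t
    push_cast
    congr 1 <;> ring_nf
  have hint' : IntervalIntegrable
      (fun t : ℝ => (1 - y * t) ^ x / (1 - y * t * (1 - t))) MeasureTheory.volume 0 1 := by
    simp only [hrefl]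
    simpa using ((hint x).comp_sub_left 1).symm
  refine ⟨by simpa only [sub_div] using (hint (-x)).sub (hint x), ?_⟩
  convert hasSum_integral_cyclePoly hx hy using 1
  simp only [sub_div]
  rw [intervalIntegral.integral_sub (hint _) (hint _), intervalIntegral.integral_sub (hint _) hint']
  congr 1
  simp only [hrefl]
  rw [intervalIntegral.integral_comp_sub_left
    (fun t : ℝ => (1 - y * (1 - t)) ^ x / (1 - y * t * (1 - t))) 1]
  simp
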